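/- Let $X$ be a (nonempty) CAT(0) space, i.e. a proper geodesic metric space all of whose geodesic triangles are at least as thin as their Euclidean comparison triangles, and let a group $G$ act on $X$ by isometries and properly: for every compact $K\subset X$ the set $\{g\in G : gK\cap K\neq\emptyset\}$ is finite. Let $\partial X$ be the visual boundary of $X$ (classes of asymptotic unit speed geodesic rays) with the visual (cone) topology and the induced action of $G$. For $a,b\in\partial X$ put $\angle(a,b)=\sup_{p\in X}\angle_p(a,b)$, and let $d_T\colon\partial X\times\partial X\to[0,\infty]$ be the Tits metric, i.e. the length metric associated with the metric $\angle$. Let $Z$ be a topological space with an action of $G$, and let $\tau\colon\partial X\to Z$ be a $G$-equivariant topological quotient map such that $\tau(a)=\tau(b)$ for all $a,b\in\partial X$ with $d_T(a,b)\le\frac{\pi}{2}$. Then the action of $G$ on $Z$ is a convergence action: $Z$ is compact, $G$ acts on $Z$ by homeomorphisms, and every sequence of distinct elements of $G$ has a subsequence $(g_i)$ for which there are points $n,p\in Z$ such that, for every closed set $K\subset Z$ with $n\notin K$ and every open set $U\subset Z$ with $p\in U$, one has $g_i(K)\subset U$ for all sufficiently large $i$. (If $Z$ is Hausdorff, the closed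 sets $K$ here are exactly the compact ones, and this is the usual definition of a convergence action.) -/

import Mathlib

namespace CATZero

open scoped NNReal ENNReal Topology

/-- `γ` restricts to a unit speed geodesic segment `[0, l] → X` from `x` to `y`, where
`l = dist x y`. -/
def IsGeodesicSegment {X : Type*} [MetricSpace X] (γ : ℝ → X) (x y : X) : Prop :=
  γ 0 = x ∧ γ (dist x y) = y ∧
    ∀ s ∈ Set.Icc 0 (dist x y), ∀ t ∈ Set.Icc 0 (dist x y), dist (γ s) (γ t) = |s - t|

/-- A geodesic metric space all of whose geodesic triangles are at least as thin as their
comparison triangles in the Euclidean plane. Any two points of a triangle lie on two of its sides,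
which have a common vertex, called `x` here; the third side `[y, z]` only enters through its
length. -/
structure IsCAT0 (X : Type*) [MetricSpace X] : Prop where
  geodesic : ∀ x y : X, ∃ γ : ℝ → X, IsGeodesicSegment γ x y
  thin : ∀ (x y z : X) (α β : ℝ → X), IsGeodesicSegment α x y → IsGeodesicSegment β x z →
    ∀ x' y' z' : EuclideanSpace ℝ (Fin 2),
      dist x' y' = dist x y → dist x' z' = dist x z → dist y' z' = dist y z →
    ∀ s ∈ Set.Icc 0 (dist x y), ∀ t ∈ Set.Icc 0 (dist x z),
    ∀ p' ∈ segment ℝ x' y', ∀ q' ∈ segment ℝ x' z', dist x' p' = s → dist x' q' = t →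
      dist (α s) (β t) ≤ dist p' q'

/-- Unit speed geodesic rays `[0, ∞) → X`. -/
def Ray (X : Type*) [MetricSpace X] : Type _ := {c : ℝ≥0 → X // Isometry c}

/-- Two rays are asymptotic if they stay at bounded distance. -/
def raySetoid (X : Type*) [MetricSpace X] : Setoid (Ray X) where
  r R S := ∃ C : ℝ, ∀ t : ℝ≥0, dist (R.1 t) (S.1 t) ≤ C
  iseqv :=
    { refl := fun R => ⟨0, fun t => by simp⟩
      symm := fun {R S} h => by
        obtain ⟨C, hC⟩ := h
        exact ⟨C, fun t => by rw [dist_comm]; exact hC t⟩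
      trans := fun {R S T} h h' => by
        obtain ⟨C, hC⟩ := h
        obtain ⟨D, hD⟩ := h'
        exact ⟨C + D, fun t => (dist_triangle _ (S.1 t) _).trans (add_le_add (hC t) (hD t))⟩ }

/-- The visual boundary `∂X` as a set. -/
def Boundary (X : Type*) [MetricSpace X] : Type _ := Quotient (raySetoid X)

/-- The endpoint of a ray in the boundary. -/
def Ray.endpoint {X : Type*} [MetricSpace X] (R : Ray X) : Boundary X := Quotient.mk (raySetoid X) R

/-- The set of boundary points `z` such that the ray `S` from the origin of `R` to `z` satisfies
`d (R r) (S r) < ε`. -/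
def basicOpen {X : Type*} [MetricSpace X] (R : Ray X) (r : ℝ≥0) (ε : ℝ) : Set (Boundary X) :=
  {z | ∃ S : Ray X, S.1 0 = R.1 0 ∧ S.endpoint = z ∧ dist (R.1 r) (S.1 r) < ε}

/-- The visual (cone) topology on `∂X`, defined with the base point `o`. -/
@[reducible] def visualTopology {X : Type*} [MetricSpace X] (o : X) : TopologicalSpace (Boundary X) :=
  TopologicalSpace.generateFrom
    {U | ∃ (R : Ray X) (r : ℝ≥0) (ε : ℝ), R.1 0 = o ∧ 0 < r ∧ 0 < ε ∧ U = basicOpen R r ε}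

/-- The Euclidean angle at the vertex corresponding to `p` in a comparison triangle of `p, a, b`
(by the law of cosines), for `a ≠ p ≠ b`. -/
noncomputable def comparisonAngle {X : Type*} [MetricSpace X] (p a b : X) : ℝ :=
  Real.arccos ((dist p a ^ 2 + dist p b ^ 2 - dist a b ^ 2) / (2 * dist p a * dist p b))

/-- The angle between two rays with the same origin. In a CAT(0) space the upper limit is a limit,
because comparison angles are monotone. -/
noncomputable def rayAngle {X : Type*} [MetricSpace X] (R S : Ray X) : ℝ :=
  Filter.limsup (fun q : ℝ≥0 × ℝ≥0 => comparisonAngle (R.1 0) (R.1 q.1) (S.1 q.2))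
    (𝓝[>] (0 : ℝ≥0) ×ˢ 𝓝[>] (0 : ℝ≥0))

/-- The angle `∠(a, b) = sup_p ∠_p(a, b)` between boundary points, where `∠_p(a, b)` is the angle
between the rays from `p` to `a` and from `p` to `b`. -/
noncomputable def angle {X : Type*} [MetricSpace X] (a b : Boundary X) : ℝ :=
  sSup {θ : ℝ | ∃ R S : Ray X, R.1 0 = S.1 0 ∧ R.endpoint = a ∧ S.endpoint = b ∧ θ = rayAngle R S}

/-- Continuity of a path in `∂X` with respect to the angular metric. -/
def AngleContinuous {X : Type*} [MetricSpace X] (c : unitInterval → Boundary X) : Prop :=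
  ∀ t : unitInterval, ∀ ε > (0 : ℝ), ∃ δ > (0 : ℝ), ∀ s : unitInterval,
    dist s t < δ → angle (c s) (c t) < ε

/-- The length of a path in `∂X` with respect to the angular metric. -/
noncomputable def angleLength {X : Type*} [MetricSpace X] (c : unitInterval → Boundary X) : ℝ≥0∞ :=
  ⨆ (n : ℕ) (u : ℕ → unitInterval) (_ : Monotone u),
    ∑ i ∈ Finset.range n, ENNReal.ofReal (angle (c (u i)) (c (u (i + 1))))

/-- The Tits metric: the path metric of the angular metric, `∞` if no path of finite length
joins the two points. -/
noncomputable def titsDist {X : Type*} [MetricSpace X] (a b : Boundary X) : ℝ≥0∞ :=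
  ⨅ (c : unitInterval → Boundary X) (_ : AngleContinuous c) (_ : c 0 = a) (_ : c 1 = b),
    angleLength c

section Action

variable {G X : Type*} [Group G] [MetricSpace X] [MulAction G X] [IsIsometricSMul G X]

instance : MulAction G (Ray X) where
  smul g R := ⟨fun t => g • R.1 t, (isometry_smul X g).comp R.2⟩
  one_smul R := Subtype.ext (funext fun t => one_smul G (R.1 t))
  mul_smul g h R := Subtype.ext (funext fun t => mul_smul g h (R.1 t))

/-- The action on `∂X` induced by an isometric action on `X`. -/
instance : MulAction G (Boundary X) where
  smul g := Quotient.map (fun R : Ray X => g • R) (fun R S h => by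
    obtain ⟨C, hC⟩ := h
    exact ⟨C, fun t => (dist_smul g (R.1 t) (S.1 t)).trans_le (hC t)⟩)
  one_smul z := Quotient.inductionOn z fun R =>
    congrArg (Quotient.mk (raySetoid X)) (one_smul G R)
  mul_smul g h z := Quotient.inductionOn z fun R =>
    congrArg (Quotient.mk (raySetoid X)) (mul_smul g h R)

end Action

/-- `G` acts on the compact space `Z` by homeomorphisms, and every sequence of distinct elements
of `G` has a subsequence `(g_i)` with points `n, p` such that `g_i → p` uniformly on the compact
subsets of `Z - {n}`. In a compact Hausdorff space the compact sets are the closed ones; the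
definition is written with closed sets, so that it makes sense for any compact space `Z`. -/
structure IsConvergenceAction (G Z : Type*) [Group G] [TopologicalSpace Z] [MulAction G Z] :
    Prop where
  compact : CompactSpace Z
  continuous_smul : ∀ g : G, Continuous fun z : Z => g • z
  convergence : ∀ g : ℕ → G, Function.Injective g →
    ∃ φ : ℕ → ℕ, StrictMono φ ∧ ∃ n p : Z,
      ∀ K : Set Z, IsClosed K → n ∉ K → ∀ U : Set Z, IsOpen U → p ∈ U →
        ∀ᶠ i in Filter.atTop, ∀ z ∈ K, g (φ i) • z ∈ U

end CATZero

namespace CATZero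

open scoped NNReal ENNReal Topology
open Filter

/-! A triangle in a CAT(0) space, even with one ideal vertex, cannot have two obtuse angles; this
forces the dynamics. Pass to a subsequence `h i` such that `h i • o` tends to a boundary point `p`
and `(h i)⁻¹ • o` to a boundary point `n`. If convergence away from `τ n` to `τ p` fails, then along
an ultrafilter there are boundary points `c i → a` with `h i • c i → b`, `τ a ≠ τ n` and `τ b ≠ τ
p`.

Suppose the rays from `o` to two boundary points are at distance at most `κ * k` at every natural
time `k`, with `κ < 2`. Then the segments joining them at time `k` stay at distance proportional to
`k` from `o`, and projecting them radially to infinity gives a Lipschitz path for the angular metric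
(`exists_lipschitz_path`). Short pieces of it have Tits length at most `π / 2`, so `τ` is constant
along it (`eq_of_lipschitz_path`).

Taking `κ = √2`, the chord of a right angle, distinct images under `τ` force a distance above `√2 *
T` at some time `T`, an open condition (`exists_eventually_obtuse`). Applied to `a, n` and to `b,
p`, it makes both base angles of the ideal triangle `o`, `(h i)⁻¹ • o`, `c i` obtuse for some `i`,
contradicting `not_both_obtuse`. -/

variable {X : Type*} [MetricSpace X]

/-! ### Comparison geometry of segments and rays -/

/-- The comparison inequality in the form of the law of cosines. -/
theorem IsCAT0.dist_sq_le (hX : IsCAT0 X) {x y z : X} {α β : ℝ → X}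
    (hα : IsGeodesicSegment α x y) (hβ : IsGeodesicSegment β x z)
    (hy : 0 < dist x y) (hz : 0 < dist x z) {s t : ℝ}
    (hs : s ∈ Set.Icc 0 (dist x y)) (ht : t ∈ Set.Icc 0 (dist x z)) :
    dist (α s) (β t) ^ 2 ≤ s ^ 2 + t ^ 2 -
      s * t * ((dist x y ^ 2 + dist x z ^ 2 - dist y z ^ 2) / (dist x y * dist x z)) := by
  have h1 := dist_triangle x y z
  have h2 := dist_triangle_left x y z
  have h2' : dist x y ≤ dist x z + dist y z := by
    have := dist_triangle x z y; rwa [dist_comm z y] at this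
  have h3 : dist y z ≤ dist x y + dist x z := by
    have := dist_triangle y x z; rwa [dist_comm y x] at this
  have key := hX.thin x y z α β hα hβ
  have hD : 0 ≤ dist y z := dist_nonneg
  generalize dist x y = A at *
  generalize dist x z = B at *
  generalize dist y z = D at *
  -- `u` and `v` are the cosine and sine of the comparison angle at `x`. The comparison triangle is
  -- placed with `x'` at the origin and `y'` on the first axis.
  obtain ⟨u, hu⟩ : ∃ u, u = (A ^ 2 + B ^ 2 - D ^ 2) / (2 * A * B) := ⟨_, rfl⟩
  have hAB : 0 < 2 * A * B := by positivity
  have hmul : u * (2 * A * B) = A ^ 2 + B ^ 2 - D ^ 2 := by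
    rw [hu, div_mul_cancel₀ _ hAB.ne']
  have hu1 : u ≤ 1 := by
    rw [hu, div_le_one hAB]; nlinarith
  have hu2 : -1 ≤ u := by
    rw [hu, le_div_iff₀ hAB]; nlinarith
  obtain ⟨v, hv⟩ : ∃ v, v = √(1 - u ^ 2) := ⟨_, rfl⟩
  have hv2 : v ^ 2 = 1 - u ^ 2 := by rw [hv, Real.sq_sqrt]; nlinarith
  have hfrac : (A ^ 2 + B ^ 2 - D ^ 2) / (A * B) = 2 * u := by
    rw [hu]; field_simp
  rw [hfrac]
  have hd : ∀ a b c d : ℝ, dist (!₂[a, b] : EuclideanSpace ℝ (Fin 2)) !₂[c, d] =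
      √((a - c) ^ 2 + (b - d) ^ 2) := by
    intro a b c d
    simp [EuclideanSpace.dist_eq, Fin.sum_univ_two, Real.dist_eq, sq_abs]
  have hseg : ∀ (r C : ℝ) (a b : ℝ), 0 < C → r ∈ Set.Icc 0 C →
      (!₂[r * a, r * b] : EuclideanSpace ℝ (Fin 2)) ∈
        segment ℝ !₂[(0 : ℝ), 0] !₂[C * a, C * b] := by
    intro r C a b hC hr
    refine ⟨1 - r / C, r / C, ?_, div_nonneg hr.1 hC.le, by ring, ?_⟩
    · rw [sub_nonneg, div_le_one hC]; exact hr.2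
    · ext i
      fin_cases i <;> simp <;> field_simp
  have := key !₂[0, 0] !₂[A * 1, A * 0] !₂[B * u, B * v]
    (by rw [hd, show (0 - A * 1) ^ 2 + (0 - A * 0) ^ 2 = A ^ 2 by ring, Real.sqrt_sq hy.le])
    (by rw [hd, show (0 - B * u) ^ 2 + (0 - B * v) ^ 2 = B ^ 2 by
          linear_combination B ^ 2 * hv2, Real.sqrt_sq hz.le])
    (by rw [hd, show (A * 1 - B * u) ^ 2 + (A * 0 - B * v) ^ 2 = D ^ 2 by
          linear_combination B ^ 2 * hv2 - hmul, Real.sqrt_sq hD])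
    s hs t ht !₂[s * 1, s * 0] (hseg _ _ _ _ hy hs) !₂[t * u, t * v] (hseg _ _ _ _ hz ht)
    (by rw [hd, show (0 - s * 1) ^ 2 + (0 - s * 0) ^ 2 = s ^ 2 by ring, Real.sqrt_sq hs.1])
    (by rw [hd, show (0 - t * u) ^ 2 + (0 - t * v) ^ 2 = t ^ 2 by
          linear_combination t ^ 2 * hv2, Real.sqrt_sq ht.1])
  rw [hd] at this
  calc dist (α s) (β t) ^ 2 ≤ √((s * 1 - t * u) ^ 2 + (s * 0 - t * v) ^ 2) ^ 2 := by gcongr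
    _ = (s * 1 - t * u) ^ 2 + (s * 0 - t * v) ^ 2 := Real.sq_sqrt (by positivity)
    _ = s ^ 2 + t ^ 2 - s * t * (2 * u) := by linear_combination t ^ 2 * hv2
    _ ≤ _ := le_rfl

/-- Two geodesics with a common origin diverge at least linearly. -/
theorem IsCAT0.dist_le_mul_div (hX : IsCAT0 X) {x y z : X} {α β : ℝ → X}
    (hα : IsGeodesicSegment α x y) (hβ : IsGeodesicSegment β x z) {m s : ℝ} (hm : 0 < m)
    (hy : m ≤ dist x y) (hz : m ≤ dist x z) (hs : 0 ≤ s) (hsy : s ≤ dist x y)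
    (hsz : s ≤ dist x z) : dist (α s) (β s) ≤ s * (dist y z / m) := by
  have hA := hm.trans_le hy
  have hB := hm.trans_le hz
  have h := hX.dist_sq_le hα hβ hA hB ⟨hs, hsy⟩ ⟨hs, hsz⟩
  refine (pow_le_pow_iff_left₀ dist_nonneg (by positivity) two_ne_zero).1 (h.trans ?_)
  have e : s ^ 2 + s ^ 2 - s * s * ((dist x y ^ 2 + dist x z ^ 2 - dist y z ^ 2) /
      (dist x y * dist x z)) =
      s ^ 2 * ((dist y z ^ 2 - (dist x y - dist x z) ^ 2) / (dist x y * dist x z)) := by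
    field_simp; ring
  rw [e, mul_pow, div_pow]
  gcongr ?_ * (?_ / ?_)
  · nlinarith [sq_nonneg (dist x y - dist x z)]
  · nlinarith

theorem IsCAT0.eqOn_segment (hX : IsCAT0 X) {x y : X} {α β : ℝ → X}
    (hα : IsGeodesicSegment α x y) (hβ : IsGeodesicSegment β x y) {s : ℝ}
    (hs : s ∈ Set.Icc 0 (dist x y)) : α s = β s := by
  rcases (dist_nonneg (x := x) (y := y)).eq_or_lt with h | h
  · have : s = 0 := le_antisymm (h ▸ hs.2) hs.1
    rw [this, hα.1, hβ.1]
  · have := hX.dist_le_mul_div hα hβ h le_rfl le_rfl hs.1 hs.2 hs.2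
    simpa using this

theorem IsGeodesicSegment.reverse {γ : ℝ → X} {x y : X} (h : IsGeodesicSegment γ x y) :
    IsGeodesicSegment (fun t => γ (dist x y - t)) y x := by
  refine ⟨by simpa using h.2.1, by simpa [dist_comm y x] using h.1, fun s hs t ht => ?_⟩
  rw [dist_comm y x] at hs ht
  rw [h.2.2 _ ⟨by linarith [hs.2], by linarith [hs.1]⟩ _ ⟨by linarith [ht.2], by linarith [ht.1]⟩,
    abs_sub_comm]
  congr 1; ring

theorem Ray.dist_eq (R : Ray X) (s t : ℝ≥0) : dist (R.1 s) (R.1 t) = |(s : ℝ) - t| := by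
  rw [R.2.dist_eq, NNReal.dist_eq]

theorem Ray.dist_zero (R : Ray X) (t : ℝ≥0) : dist (R.1 0) (R.1 t) = t := by
  simp [R.dist_eq]

theorem Ray.isGeodesicSegment (R : Ray X) (T : ℝ≥0) :
    IsGeodesicSegment (fun t => R.1 t.toNNReal) (R.1 0) (R.1 T) := by
  refine ⟨by simp, by simp [R.dist_zero], fun s hs t ht => ?_⟩
  rw [R.dist_eq, Real.coe_toNNReal _ hs.1, Real.coe_toNNReal _ ht.1]

theorem Ray.endpoint_eq_iff {R S : Ray X} :
    R.endpoint = S.endpoint ↔ ∃ C : ℝ, ∀ t : ℝ≥0, dist (R.1 t) (S.1 t) ≤ C :=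
  Quotient.eq (r := raySetoid X)

theorem Ray.smul_apply {G : Type*} [Group G] [MulAction G X] [IsIsometricSMul G X] (g : G)
    (R : Ray X) (t : ℝ≥0) : (g • R).1 t = g • R.1 t := rfl

theorem Ray.smul_endpoint {G : Type*} [Group G] [MulAction G X] [IsIsometricSMul G X] (g : G)
    (R : Ray X) : (g • R).endpoint = g • R.endpoint := rfl

/-! ### Asymptotic rays from a given origin -/

/-- A chosen geodesic segment between two points. -/
noncomputable def IsCAT0.geod (hX : IsCAT0 X) (x y : X) : ℝ → X := (hX.geodesic x y).choose

theorem IsCAT0.geod_spec (hX : IsCAT0 X) (x y : X) : IsGeodesicSegment (hX.geod x y) x y :=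
  (hX.geodesic x y).choose_spec

/-- Geodesics of lengths tending to infinity with a common origin converge to a ray along every
ultrafilter. -/
theorem exists_limit_ray [ProperSpace X] {ι : Type*} (l : Ultrafilter ι) (o : X) (γ : ι → ℝ → X)
    (h0 : ∀ i, γ i 0 = o)
    (h : ∀ T : ℝ, ∀ᶠ i in l, ∀ s ∈ Set.Icc 0 T, ∀ t ∈ Set.Icc 0 T,
      dist (γ i s) (γ i t) = |s - t|) :
    ∃ R : Ray X, R.1 0 = o ∧ ∀ t : ℝ≥0, Tendsto (fun i => γ i t) l (𝓝 (R.1 t)) := by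
  have lim : ∀ t : ℝ≥0, ∃ x, Tendsto (fun i => γ i t) l (𝓝 x) := by
    intro t
    have hb : ∀ᶠ i in l, γ i t ∈ Metric.closedBall o t := by
      filter_upwards [h t] with i hi
      have := hi t ⟨t.2, le_rfl⟩ 0 ⟨le_rfl, t.2⟩
      rw [h0] at this
      simp [this]
    obtain ⟨x, -, hx⟩ := (isCompact_closedBall o (t : ℝ)).ultrafilter_le_nhds
      (l.map fun i => γ i t) (le_principal_iff.2 hb)
    exact ⟨x, hx⟩
  choose c hc using lim
  refine ⟨⟨c, Isometry.of_dist_eq fun s t => ?_⟩, ?_, hc⟩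
  · refine tendsto_nhds_unique ((hc s).dist (hc t)) (Tendsto.congr' ?_ tendsto_const_nhds)
    filter_upwards [h (max s t)] with i hi
    rw [hi s ⟨s.2, le_max_left _ _⟩ t ⟨t.2, le_max_right _ _⟩, NNReal.dist_eq]
  · refine tendsto_nhds_unique (hc 0) (Tendsto.congr ?_ tendsto_const_nhds)
    intro i
    simp [h0]

theorem IsGeodesicSegment.eventually_isometry {ι : Type*} {l : Filter ι} {γ : ι → ℝ → X}
    {x : X} {y : ι → X} (hγ : ∀ i, IsGeodesicSegment (γ i) x (y i))
    (hy : Tendsto (fun i => dist x (y i)) l atTop) (T : ℝ) :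
    ∀ᶠ i in l, ∀ s ∈ Set.Icc 0 T, ∀ t ∈ Set.Icc 0 T, dist (γ i s) (γ i t) = |s - t| := by
  filter_upwards [hy.eventually_ge_atTop T] with i hi s hs t ht
  exact (hγ i).2.2 s ⟨hs.1, hs.2.trans hi⟩ t ⟨ht.1, ht.2.trans hi⟩

/-- Asymptotic rays with the same origin coincide. -/
theorem IsCAT0.ray_unique (hX : IsCAT0 X) {R S : Ray X} (h0 : R.1 0 = S.1 0)
    (h : R.endpoint = S.endpoint) : R = S := by
  obtain ⟨C, hC⟩ := Ray.endpoint_eq_iff.1 h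
  refine Subtype.ext (funext fun t => ?_)
  have hle : ∀ n : ℕ, 0 < n → (t : ℝ) ≤ n → dist (R.1 t) (S.1 t) ≤ t * (C / n) := by
    intro n hn htn
    have hS := S.isGeodesicSegment n
    rw [← h0] at hS
    have hSd := S.dist_zero n
    rw [← h0] at hSd
    have hn' : (0 : ℝ) < n := by exact_mod_cast hn
    have := hX.dist_le_mul_div (R.isGeodesicSegment n) hS (m := n) (s := (t : ℝ)) hn'
      (by rw [R.dist_zero]; simp) (by rw [hSd]; simp) t.2 (by rw [R.dist_zero]; simpa using htn)
      (by rw [hSd]; simpa using htn)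
    rw [Real.toNNReal_coe] at this
    refine this.trans ?_
    gcongr
    exact hC n
  have hlim : Tendsto (fun n : ℕ => (t : ℝ) * (C / n)) atTop (𝓝 0) := by
    simpa using (tendsto_const_div_atTop_nhds_zero_nat C).const_mul (t : ℝ)
  have := ge_of_tendsto hlim (b := dist (R.1 t) (S.1 t)) (by
    filter_upwards [eventually_gt_atTop 0, eventually_ge_atTop ⌈(t : ℝ)⌉₊] with n hn hn'
    exact hle n hn (Nat.ceil_le.1 hn'))
  exact dist_le_zero.1 this

/-- The bound does not depend on `n`, so it survives the limit that produces the ray from `o`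
asymptotic to `S`. -/
theorem IsCAT0.dist_geod_ray_le (hX : IsCAT0 X) (o : X) (S : Ray X) {n t : ℝ≥0} (htn : t ≤ n)
    (hto : t ≤ dist o (S.1 n)) :
    dist (hX.geod o (S.1 n) t) (S.1 t) ≤ 2 * dist o (S.1 0) := by
  set A := dist o (S.1 n) with hA
  have hSd := S.dist_zero n
  -- Both segments end at `S.1 n`, so they are read backwards from this common vertex.
  have hα := (hX.geod_spec o (S.1 n)).reverse
  have hβ := (S.isGeodesicSegment n).reverse
  have htn' : (t : ℝ) ≤ n := htn
  have hAn : |A - n| ≤ dist o (S.1 0) := by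
    have h1 := dist_triangle o (S.1 0) (S.1 n)
    have h2 := dist_triangle (S.1 0) o (S.1 n)
    rw [dist_comm (S.1 0) o] at h2
    rw [abs_le]; constructor <;> linarith
  -- The largest backward time at which neither segment has passed its parameter `t`. There the gap
  -- is at most `dist o (S.1 0)`; moving on to `t` along both costs `|A - n|` in all, which has the
  -- same bound.
  set s := min (A - t) (n - t) with hs
  have hs0 : 0 ≤ s := le_min (by linarith) (by linarith)
  have hsA : s ≤ A := (min_le_left _ _).trans (by linarith [t.2])
  have hsn : s ≤ n := (min_le_right _ _).trans (by linarith [t.2])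
  have h1 : dist (hX.geod o (S.1 n) (A - s)) (S.1 (n - s : ℝ).toNNReal) ≤ dist o (S.1 0) := by
    rcases hs0.eq_or_lt with h | h
    · rw [← h]
      simp [hA, (hX.geod_spec o (S.1 n)).2.1]
    · have := hX.dist_le_mul_div hα hβ (m := s) h (by rw [dist_comm]; exact hsA)
        (by rw [dist_comm, hSd]; exact hsn) hs0 (by rw [dist_comm]; exact hsA)
        (by rw [dist_comm, hSd]; exact hsn)
      simp only [hSd] at this
      rwa [mul_div_cancel₀ _ h.ne'] at this
  have hsum : (A - s - t) + (n - s - t) = |A - n| := by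
    rcases le_total A n with h | h
    · rw [hs, min_eq_left (by linarith), abs_of_nonpos (by linarith)]; ring
    · rw [hs, min_eq_right (by linarith), abs_of_nonneg (by linarith)]; ring
  have hsA' : s ≤ A - t := min_le_left _ _
  have hsn' : s ≤ n - t := min_le_right _ _
  have h2 : dist (hX.geod o (S.1 n) t) (hX.geod o (S.1 n) (A - s)) = A - s - t := by
    rw [(hX.geod_spec o (S.1 n)).2.2 t ⟨t.2, hto⟩ _ ⟨by linarith, by linarith⟩, abs_sub_comm,
      abs_of_nonneg (by linarith)]
  have h3 : dist (S.1 (n - s : ℝ).toNNReal) (S.1 t) = n - s - t := by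
    rw [S.dist_eq, Real.coe_toNNReal _ (by linarith), abs_of_nonneg (by linarith)]
  have := dist_triangle4 (hX.geod o (S.1 n) t) (hX.geod o (S.1 n) (A - s))
    (S.1 (n - s : ℝ).toNNReal) (S.1 t)
  linarith

theorem Ray.tendsto_dist (S : Ray X) (o : X) :
    Tendsto (fun n : ℕ => dist o (S.1 n)) atTop atTop := by
  refine tendsto_atTop_mono (f := fun n : ℕ => (n : ℝ) - dist o (S.1 0)) (fun n => ?_)
    (tendsto_atTop_add_const_right _ _ tendsto_natCast_atTop_atTop)
  have h1 := S.dist_zero n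
  have h2 := dist_triangle_left (S.1 0) (S.1 n) o
  simp only [NNReal.coe_natCast] at h1
  linarith

theorem IsCAT0.exists_ray [ProperSpace X] (hX : IsCAT0 X) (o : X) (S : Ray X) :
    ∃ R : Ray X, R.1 0 = o ∧ R.endpoint = S.endpoint ∧
      ∀ t, dist (R.1 t) (S.1 t) ≤ 2 * dist o (S.1 0) := by
  have hle : ((hyperfilter ℕ : Ultrafilter ℕ) : Filter ℕ) ≤ atTop := Nat.hyperfilter_le_atTop
  obtain ⟨R, hR0, hR⟩ := exists_limit_ray (hyperfilter ℕ) o (fun n => hX.geod o (S.1 n))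
    (fun n => (hX.geod_spec _ _).1)
    (IsGeodesicSegment.eventually_isometry (fun n => hX.geod_spec _ _)
      ((S.tendsto_dist o).mono_left hle))
  have hb : ∀ t, dist (R.1 t) (S.1 t) ≤ 2 * dist o (S.1 0) := by
    intro t
    refine le_of_tendsto ((hR t).dist tendsto_const_nhds) ?_
    refine Filter.Eventually.filter_mono hle ?_
    filter_upwards [(S.tendsto_dist o).eventually_ge_atTop t,
      eventually_ge_atTop ⌈(t : ℝ)⌉₊] with n hn hn'
    exact hX.dist_geod_ray_le o S (by exact_mod_cast Nat.ceil_le.1 hn') hn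
  exact ⟨R, hR0, Ray.endpoint_eq_iff.2 ⟨_, hb⟩, hb⟩

/-- By uniqueness `S`'s asymptote from `R.1 0` is `R` itself. The unspecified constant of
asymptoticity thus becomes one that depends only on the origins and passes to limits of rays. -/
theorem IsCAT0.dist_le_of_asymptotic [ProperSpace X] (hX : IsCAT0 X) {R S : Ray X}
    (h : R.endpoint = S.endpoint) (t : ℝ≥0) :
    dist (R.1 t) (S.1 t) ≤ 2 * dist (R.1 0) (S.1 0) := by
  obtain ⟨R', h0, h1, h2⟩ := hX.exists_ray (R.1 0) S
  obtain rfl := hX.ray_unique h0 (h1.trans h.symm)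
  exact h2 t

theorem IsCAT0.exists_rayTo [ProperSpace X] (hX : IsCAT0 X) (o : X) (z : Boundary X) :
    ∃ R : Ray X, R.1 0 = o ∧ R.endpoint = z := by
  obtain ⟨S, rfl⟩ : ∃ S : Ray X, S.endpoint = z := Quotient.exists_rep z
  obtain ⟨R, h0, h1, -⟩ := hX.exists_ray o S
  exact ⟨R, h0, h1⟩

/-- The ray from `o` to the boundary point `z`. -/
noncomputable def IsCAT0.rayTo [ProperSpace X] (hX : IsCAT0 X) (o : X) (z : Boundary X) : Ray X :=
  (hX.exists_rayTo o z).choose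

/-! ### The cone topology through rays from the base point -/

section RayTo

variable [ProperSpace X]

theorem IsCAT0.rayTo_zero (hX : IsCAT0 X) (o : X) (z : Boundary X) : (hX.rayTo o z).1 0 = o :=
  (hX.exists_rayTo o z).choose_spec.1

theorem IsCAT0.rayTo_endpoint (hX : IsCAT0 X) (o : X) (z : Boundary X) :
    (hX.rayTo o z).endpoint = z :=
  (hX.exists_rayTo o z).choose_spec.2

theorem IsCAT0.eq_rayTo (hX : IsCAT0 X) (o : X) {R : Ray X} (h : R.1 0 = o) :
    R = hX.rayTo o R.endpoint :=
  hX.ray_unique (h.trans (hX.rayTo_zero o _).symm) (hX.rayTo_endpoint o _).symm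

/-- Only subbasic sets need testing, and uniqueness identifies the ray in `basicOpen` with `rayTo`.
Time `0` is separate because `basicOpen` is used with positive times only. -/
theorem IsCAT0.tendsto_nhds_iff (hX : IsCAT0 X) (o : X) {ι : Type*} {l : Filter ι} {f :
    ι → Boundary X} {a : Boundary X} :
    Tendsto f l (@nhds _ (visualTopology o) a) ↔
      ∀ t, Tendsto (fun i => (hX.rayTo o (f i)).1 t) l (𝓝 ((hX.rayTo o a).1 t)) := by
  rw [TopologicalSpace.tendsto_nhds_generateFrom_iff]
  constructor
  · intro h t
    rcases (zero_le (a := t)).eq_or_lt with rfl | ht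
    · simpa [hX.rayTo_zero] using tendsto_const_nhds
    refine Metric.tendsto_nhds.2 fun ε hε => ?_
    have := h (basicOpen (hX.rayTo o a) t ε) ⟨_, t, ε, hX.rayTo_zero o a, ht, hε, rfl⟩
      ⟨_, rfl, hX.rayTo_endpoint o a, by simpa using hε⟩
    filter_upwards [this] with i hi
    obtain ⟨S, hS0, hS, hd⟩ := hi
    rw [hX.rayTo_zero] at hS0
    rw [hX.eq_rayTo o hS0, hS] at hd
    rwa [dist_comm]
  · rintro h _ ⟨R, r, ε, hR, -, -, rfl⟩ ⟨S, hS0, rfl, hd⟩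
    rw [hX.eq_rayTo o (hS0.trans hR)] at hd
    have := (tendsto_const_nhds.dist (h r)).eventually (gt_mem_nhds hd)
    filter_upwards [this] with i hi
    exact ⟨_, (hX.rayTo_zero o _).trans hR.symm, hX.rayTo_endpoint o _, hi⟩

theorem IsCAT0.exists_tendsto_rayTo (hX : IsCAT0 X) (o : X) {ι : Type*} (l : Ultrafilter ι) (f :
    ι → Boundary X) :
    ∃ a, ∀ t, Tendsto (fun i => (hX.rayTo o (f i)).1 t) l (𝓝 ((hX.rayTo o a).1 t)) := by
  obtain ⟨R, hR0, hR⟩ := exists_limit_ray l o (fun i t => (hX.rayTo o (f i)).1 t.toNNReal)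
    (fun i => by simp [hX.rayTo_zero])
    (fun T => Eventually.of_forall fun i s hs t ht => by
      rw [Ray.dist_eq, Real.coe_toNNReal _ hs.1, Real.coe_toNNReal _ ht.1])
  refine ⟨R.endpoint, fun t => ?_⟩
  rw [← hX.eq_rayTo o hR0]
  simpa using hR t

theorem IsCAT0.compactSpace_boundary (hX : IsCAT0 X) (o : X) :
    @CompactSpace (Boundary X) (visualTopology o) := by
  let _ := visualTopology o
  refine ⟨isCompact_iff_ultrafilter_le_nhds.2 fun l _ => ?_⟩
  obtain ⟨a, ha⟩ := hX.exists_tendsto_rayTo o l id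
  exact ⟨a, Set.mem_univ _, (hX.tendsto_nhds_iff o).2 ha⟩

theorem IsCAT0.continuous_smul_boundary (hX : IsCAT0 X) (o : X) {G : Type*} [Group G]
    [MulAction G X]
    [IsIsometricSMul G X] (g : G) :
    @Continuous _ _ (visualTopology o) (visualTopology o) fun z : Boundary X => g • z := by
  let _ := visualTopology o
  refine continuous_iff_ultrafilter.2 fun a l hl => ?_
  have ha := (hX.tendsto_nhds_iff o (f := id)).1 hl
  obtain ⟨b, hb⟩ := hX.exists_tendsto_rayTo o l fun z => g • z
  suffices b = g • a by rw [← this]; exact (hX.tendsto_nhds_iff o).2 hb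
  rw [← hX.rayTo_endpoint o b]
  conv_rhs => rw [← hX.rayTo_endpoint o a]
  -- The ray from `o` to `g • z` and the translate by `g` of the ray to `z` are asymptotic, with a
  -- bound uniform in `z`; hence their limits are asymptotic too.
  refine (Ray.endpoint_eq_iff (S := g • hX.rayTo o a)).2 ⟨2 * dist o (g • o), fun t => ?_⟩
  refine le_of_tendsto ((hb t).dist ((ha t).const_smul g)) (Eventually.of_forall fun z => ?_)
  have := hX.dist_le_of_asymptotic (R := hX.rayTo o (g • z)) (S := g • hX.rayTo o z)
    (by rw [Ray.smul_endpoint, hX.rayTo_endpoint, hX.rayTo_endpoint]) t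
  refine this.trans_eq ?_
  rw [Ray.smul_apply, hX.rayTo_zero, hX.rayTo_zero]

end RayTo

/-! ### Angles and the Tits metric -/

/-- The left side is the apex angle of an isosceles triangle with legs `1` and base `κ`. The bound
comes from `cos x ≤ 1 - 2 / π² * x²` on `[-π, π]`, and is trivial for `κ ≥ 2`. -/
theorem arccos_one_sub_sq_div_two_le {κ : ℝ} (hκ : 0 ≤ κ) :
    Real.arccos (1 - κ ^ 2 / 2) ≤ Real.pi / 2 * κ := by
  have hpi := Real.pi_pos
  rcases le_total 2 κ with h | h
  · exact (Real.arccos_le_pi _).trans (by nlinarith)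
  have h1 := Real.cos_le_one_sub_mul_cos_sq (x := Real.arccos (1 - κ ^ 2 / 2))
    (by rw [abs_of_nonneg (Real.arccos_nonneg _)]; exact Real.arccos_le_pi _)
  rw [Real.cos_arccos (by nlinarith) (by nlinarith)] at h1
  refine (pow_le_pow_iff_left₀ (Real.arccos_nonneg _) (by positivity) two_ne_zero).1 ?_
  have h2 : 2 / Real.pi ^ 2 * Real.arccos (1 - κ ^ 2 / 2) ^ 2 ≤ κ ^ 2 / 2 := by linarith
  calc Real.arccos (1 - κ ^ 2 / 2) ^ 2
      = Real.pi ^ 2 / 2 * (2 / Real.pi ^ 2 * Real.arccos (1 - κ ^ 2 / 2) ^ 2) := by field_simp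
    _ ≤ Real.pi ^ 2 / 2 * (κ ^ 2 / 2) := by gcongr
    _ = _ := by ring

/-- Thinness bounds the comparison angles near the origin by the one at time `T`. -/
theorem IsCAT0.rayAngle_le (hX : IsCAT0 X) {R S : Ray X} (h0 : R.1 0 = S.1 0) {T : ℝ≥0}
    (hT : 0 < T) : rayAngle R S ≤ Real.pi / 2 * (dist (R.1 T) (S.1 T) / T) := by
  have hT' : (0 : ℝ) < T := hT
  refine limsup_le_of_le ?_ ?_
  · exact IsBoundedUnder.isCoboundedUnder_le ⟨0, eventually_map.2 (Eventually.of_forall fun q =>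
      Real.arccos_nonneg _)⟩
  have hev : ∀ᶠ q : ℝ≥0 in 𝓝[>] 0, 0 < q ∧ q ≤ T :=
    (eventually_mem_nhdsWithin).and (eventually_nhdsWithin_of_eventually_nhds (Iic_mem_nhds hT))
  filter_upwards [hev.prod_mk hev] with q hq
  obtain ⟨⟨hs, hsT⟩, ht, htT⟩ := hq
  have hs' : (0 : ℝ) < q.1 := hs
  have ht' : (0 : ℝ) < q.2 := ht
  refine le_trans ?_ (arccos_one_sub_sq_div_two_le (by positivity))
  refine Real.arccos_le_arccos ?_
  have hSg := S.isGeodesicSegment T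
  have hSq := S.dist_zero q.2
  have hST := S.dist_zero T
  rw [← h0] at hSg hSq hST
  have hRT := R.dist_zero T
  have := hX.dist_sq_le (R.isGeodesicSegment T) hSg (by rw [hRT]; exact hT)
    (by rw [hST]; exact hT) (s := q.1) (t := q.2) ⟨hs'.le, by rw [hRT]; exact hsT⟩
    ⟨ht'.le, by rw [hST]; exact htT⟩
  rw [Real.toNNReal_coe, Real.toNNReal_coe, hRT, hST] at this
  rw [R.dist_zero, hSq, le_div_iff₀ (by positivity)]
  have e : (1 - (dist (R.1 T) (S.1 T) / T) ^ 2 / 2) * (2 * q.1 * q.2) =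
      q.1 * q.2 * (((T : ℝ) ^ 2 + (T : ℝ) ^ 2 - dist (R.1 T) (S.1 T) ^ 2) / (T * T)) := by
    field_simp; ring
  rw [e]
  linarith

/-- Moving to another origin changes the distance between the rays by a bounded amount, which is
negligible after division by time. One linear rate therefore controls the supremum over all origins.
-/
theorem IsCAT0.angle_endpoint_le (hX : IsCAT0 X) {R S : Ray X} {κ : ℝ} (hκ : 0 ≤ κ)
    (h : ∀ t : ℝ≥0, dist (R.1 t) (S.1 t) ≤ κ * t) :
    angle R.endpoint S.endpoint ≤ Real.pi / 2 * κ := by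
  refine Real.sSup_le ?_ (by have := Real.pi_pos; positivity)
  rintro _ ⟨R', S', h0, hR, hS, rfl⟩
  obtain ⟨C, hC⟩ := Ray.endpoint_eq_iff.1 hR
  obtain ⟨D, hD⟩ := Ray.endpoint_eq_iff.1 hS
  have hlim : Tendsto (fun n : ℕ => Real.pi / 2 * (κ + (C + D) / n)) atTop
      (𝓝 (Real.pi / 2 * (κ + 0))) :=
    ((tendsto_const_div_atTop_nhds_zero_nat (C + D)).const_add κ).const_mul _
  rw [add_zero] at hlim
  refine ge_of_tendsto hlim ?_
  filter_upwards [eventually_gt_atTop 0] with n hn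
  have hn' : (0 : ℝ) < n := by exact_mod_cast hn
  refine (hX.rayAngle_le h0 (T := n) (by exact_mod_cast hn)).trans ?_
  have hpi := Real.pi_pos
  gcongr
  rw [NNReal.coe_natCast, div_le_iff₀ hn', add_mul, div_mul_cancel₀ _ hn'.ne']
  have h1 := dist_triangle4 (R'.1 n) (R.1 n) (S.1 n) (S'.1 n)
  have h2 := hD n
  rw [dist_comm] at h2
  have h3 := h n
  rw [NNReal.coe_natCast] at h3
  linarith [hC n]

/-- A path which is Lipschitz for the angular metric has finite length. -/
theorem titsDist_le_of_lipschitz {c : unitInterval → Boundary X} {M : ℝ} (hM : 0 ≤ M)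
    (h : ∀ s t : unitInterval, angle (c s) (c t) ≤ M * dist s t) :
    titsDist (c 0) (c 1) ≤ ENNReal.ofReal M := by
  refine iInf_le_of_le c (iInf_le_of_le ?_ (iInf_le_of_le rfl (iInf_le_of_le rfl ?_)))
  · intro t ε hε
    refine ⟨ε / (M + 1), by positivity, fun s hs => (h s t).trans_lt ?_⟩
    rw [lt_div_iff₀ (by positivity)] at hs
    nlinarith [dist_nonneg (x := s) (y := t)]
  · refine iSup_le fun n => iSup_le fun u => iSup_le fun hu => ?_
    calc ∑ i ∈ Finset.range n, ENNReal.ofReal (angle (c (u i)) (c (u (i + 1))))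
        ≤ ∑ i ∈ Finset.range n, ENNReal.ofReal (M * ((u (i + 1) : ℝ) - u i)) := by
          gcongr with i
          refine (h _ _).trans_eq ?_
          have : (u i : ℝ) ≤ u (i + 1) := hu (Nat.le_succ i)
          rw [Subtype.dist_eq, Real.dist_eq, abs_sub_comm, abs_of_nonneg (by linarith)]
      _ = ENNReal.ofReal (∑ i ∈ Finset.range n, M * ((u (i + 1) : ℝ) - u i)) := by
          rw [ENNReal.ofReal_sum_of_nonneg]
          intro i _
          have : (u i : ℝ) ≤ u (i + 1) := hu (Nat.le_succ i)
          exact mul_nonneg hM (by linarith)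
      _ ≤ ENNReal.ofReal M := by
          rw [← Finset.mul_sum, Finset.sum_range_sub fun i => (u i : ℝ)]
          refine ENNReal.ofReal_le_ofReal ?_
          have h1 := (u n).2.2
          have h2 := (u 0).2.1
          nlinarith

/-- A map that identifies points at Tits distance at most `π / 2` is constant on paths that are
Lipschitz for the angular metric. -/
theorem eq_of_lipschitz_path {Z : Type*} {τ : Boundary X → Z}
    (hτ : ∀ a b : Boundary X, titsDist a b ≤ ENNReal.ofReal (Real.pi / 2) → τ a = τ b)
    {c : unitInterval → Boundary X} {M : ℝ} (hM : 0 ≤ M)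
    (h : ∀ s t : unitInterval, angle (c s) (c t) ≤ M * dist s t) : τ (c 0) = τ (c 1) := by
  -- The path may be longer than `π / 2`, but its restriction to a short interval, reparametrized
  -- affinely by `f`, is not.
  refine IsLocallyConstant.apply_eq_of_preconnectedSpace (f := fun t => τ (c t)) ?_ 0 1
  refine (IsLocallyConstant.iff_eventually_eq _).2 fun s => ?_
  have hev : ∀ᶠ t in 𝓝 s, M * dist s t < Real.pi / 2 := by
    have : Tendsto (fun t => M * dist s t) (𝓝 s) (𝓝 (M * dist s s)) := by
      exact (Continuous.tendsto (by fun_prop) s)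
    rw [dist_self, mul_zero] at this
    exact this.eventually (gt_mem_nhds (by have := Real.pi_pos; positivity))
  filter_upwards [hev] with t ht
  refine (hτ _ _ ?_).symm
  let f : unitInterval → unitInterval := fun r => ⟨s + r * (t - s : ℝ), by
    have h1 := s.2; have h2 := t.2; have h3 := r.2
    constructor
    · nlinarith [mul_nonneg h3.1 h2.1, mul_nonneg (sub_nonneg.2 h3.2) h1.1]
    · nlinarith [mul_nonneg h3.1 (sub_nonneg.2 h2.2),
        mul_nonneg (sub_nonneg.2 h3.2) (sub_nonneg.2 h1.2)]⟩
  have h0 : f 0 = s := Subtype.ext (by simp [f])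
  have h1 : f 1 = t := Subtype.ext (by simp [f])
  have := titsDist_le_of_lipschitz (c := fun r => c (f r)) (M := M * dist s t) (by positivity)
    (fun r r' => (h _ _).trans_eq (by
      rw [mul_assoc]
      congr 1
      simp only [Subtype.dist_eq, Real.dist_eq, f]
      rw [← abs_mul, ← abs_neg]
      congr 1; ring))
  simp only [h0, h1] at this
  exact this.trans (ENNReal.ofReal_le_ofReal ht.le)

/-! ### Lipschitz paths in the boundary -/

/-- Points of a geodesic segment are far from a point that is far from its ends. -/
theorem IsGeodesicSegment.le_dist {γ : ℝ → X} {x y o : X} (h : IsGeodesicSegment γ x y) {k : ℝ}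
    (hx : k ≤ dist o x) (hy : k ≤ dist o y) {r : ℝ} (hr : r ∈ Set.Icc 0 (dist x y)) :
    k - dist x y / 2 ≤ dist o (γ r) := by
  have h1 := h.2.2 0 ⟨le_rfl, dist_nonneg⟩ r hr
  have h2 := h.2.2 (dist x y) ⟨dist_nonneg, le_rfl⟩ r hr
  rw [h.1, zero_sub, abs_neg, abs_of_nonneg hr.1] at h1
  rw [h.2.1, abs_of_nonneg (by linarith [hr.2])] at h2
  have h3 := dist_triangle_right o x (γ r)
  have h4 := dist_triangle_right o y (γ r)
  linarith

/-- If the rays to `a` and `b` diverge at a rate less than `2`, then `a` and `b` are joined by a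
path that is Lipschitz for the angular metric. -/
theorem IsCAT0.exists_lipschitz_path [ProperSpace X] (hX : IsCAT0 X) (o : X) {a b : Boundary X}
    {κ : ℝ} (hκ0 : 0 ≤ κ) (hκ : κ < 2)
    (h : ∀ k : ℕ, dist ((hX.rayTo o a).1 k) ((hX.rayTo o b).1 k) ≤ κ * k) :
    ∃ c : unitInterval → Boundary X, c 0 = a ∧ c 1 = b ∧ ∃ M, 0 ≤ M ∧
      ∀ s t : unitInterval, angle (c s) (c t) ≤ M * dist s t := by
  set A := hX.rayTo o a with hA
  set B := hX.rayTo o b with hB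
  have hA0 : A.1 0 = o := hX.rayTo_zero o a
  have hB0 : B.1 0 = o := hX.rayTo_zero o b
  have hAk : ∀ k : ℕ, dist o (A.1 k) = k := fun k => by
    rw [← hA0, A.dist_zero, NNReal.coe_natCast]
  have hBk : ∀ k : ℕ, dist o (B.1 k) = k := fun k => by
    rw [← hB0, B.dist_zero, NNReal.coe_natCast]
  -- A point of the segment from `A.1 k` to `B.1 k` is within `κ * k / 2` of one end, hence at least
  -- `η * k` from `o`; `κ < 2` makes `η` positive.
  set η := 1 - κ / 2 with hη
  have hη0 : 0 < η := by rw [hη]; linarith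
  let m : unitInterval → ℕ → X := fun r k => hX.geod (A.1 k) (B.1 k) (r * dist (A.1 k) (B.1 k))
  have hmem : ∀ (r : unitInterval) (k : ℕ), (r : ℝ) * dist (A.1 k) (B.1 k) ∈
      Set.Icc 0 (dist (A.1 k) (B.1 k)) := fun r k =>
    ⟨mul_nonneg r.2.1 dist_nonneg, mul_le_of_le_one_left dist_nonneg r.2.2⟩
  have hm : ∀ r k, η * k ≤ dist o (m r k) := fun r k => by
    have := (hX.geod_spec (A.1 k) (B.1 k)).le_dist (hAk k).ge (hBk k).ge (hmem r k)
    refine le_trans ?_ this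
    rw [hη]
    linarith [h k]
  have hmm : ∀ r r' k, dist (m r k) (m r' k) ≤ dist r r' * (κ * k) := fun r r' k => by
    simp only [m]
    rw [(hX.geod_spec (A.1 k) (B.1 k)).2.2 _ (hmem r k) _ (hmem r' k), ← sub_mul, abs_mul,
      abs_of_nonneg (dist_nonneg (x := A.1 k)), Subtype.dist_eq, Real.dist_eq]
    gcongr
    exact h k
  have hle : ((hyperfilter ℕ : Ultrafilter ℕ) : Filter ℕ) ≤ atTop := Nat.hyperfilter_le_atTop
  have hkη : Tendsto (fun k : ℕ => η * k) atTop atTop :=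
    tendsto_natCast_atTop_atTop.const_mul_atTop hη0
  have hlim := fun r => exists_limit_ray (hyperfilter ℕ) o (fun k => hX.geod o (m r k))
    (fun k => (hX.geod_spec _ _).1)
    (IsGeodesicSegment.eventually_isometry (fun k => hX.geod_spec _ _)
      ((tendsto_atTop_mono (hm r) hkη).mono_left hle))
  choose ρ hρ0 hρ using hlim
  have hray : ∀ (r : unitInterval) (R : Ray X), R.1 0 = o → (∀ k : ℕ, m r k = R.1 k) → ρ r = R := by
    intro r R hR hk
    refine Subtype.ext (funext fun t => tendsto_nhds_unique (hρ r t)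
      (Tendsto.congr' ?_ tendsto_const_nhds))
    refine Filter.Eventually.filter_mono hle ?_
    filter_upwards [eventually_ge_atTop ⌈(t : ℝ)⌉₊] with k hk'
    have hseg := R.isGeodesicSegment k
    rw [hR] at hseg
    have hd := R.dist_zero k
    rw [hR] at hd
    rw [hk, hX.eqOn_segment (hX.geod_spec o (R.1 k)) hseg (s := (t : ℝ))
      ⟨t.2, by rw [hd]; exact Nat.ceil_le.1 hk'⟩, Real.toNNReal_coe]
  -- Points `m r k`, `m r' k` are at most `dist r r' * κ * k` apart and at least `η * k` from `o`,
  -- so the rays diverge at rate at most `dist r r' * κ / η`.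
  refine ⟨fun r => (ρ r).endpoint, ?_, ?_, Real.pi / 2 * (κ / η),
    by have := Real.pi_pos; positivity, fun r r' => ?_⟩
  · change (ρ 0).endpoint = a
    rw [hray 0 A hA0 fun k => by simp [m, (hX.geod_spec (A.1 k) (B.1 k)).1]]
    exact hX.rayTo_endpoint o a
  · change (ρ 1).endpoint = b
    rw [hray 1 B hB0 fun k => by simp [m, (hX.geod_spec (A.1 k) (B.1 k)).2.1]]
    exact hX.rayTo_endpoint o b
  · rw [mul_assoc]
    refine hX.angle_endpoint_le (by positivity) fun t => ?_
    refine le_of_tendsto ((hρ r t).dist (hρ r' t)) (Filter.Eventually.filter_mono hle ?_)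
    filter_upwards [hkη.eventually_ge_atTop t, eventually_gt_atTop 0] with k hk hk0
    have hk0' : (0 : ℝ) < k := by exact_mod_cast hk0
    refine (hX.dist_le_mul_div (hX.geod_spec _ _) (hX.geod_spec _ _) (m := η * k) (by positivity)
      (hm r k) (hm r' k) t.2 (hk.trans (hm r k)) (hk.trans (hm r' k))).trans ?_
    calc (t : ℝ) * (dist (m r k) (m r' k) / (η * k))
        ≤ t * (dist r r' * (κ * k) / (η * k)) := by gcongr; exact hmm r r' k
      _ = _ := by field_simp

/-! ### Ideal triangles with two obtuse angles -/

/-- The two base angles of the ideal triangle spanned by a segment `[o, x]` and two asymptotic rays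
cannot both be obtuse. -/
theorem IsCAT0.not_both_obtuse (hX : IsCAT0 X) {o x : X} {σ σ' : ℝ → X}
    (hσ : IsGeodesicSegment σ o x) (hσ' : IsGeodesicSegment σ' x o) {c e : Ray X}
    (hc : c.1 0 = o) (he : e.1 0 = x) (hce : c.endpoint = e.endpoint) {T S : ℝ≥0}
    (hT : 0 < T) (hTx : T ≤ dist o x) (hSx : S ≤ dist o x)
    (h : 2 * (T : ℝ) ^ 2 < dist (c.1 T) (σ T) ^ 2) :
    dist (e.1 S) (σ' S) ^ 2 ≤ 2 * (S : ℝ) ^ 2 := by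
  obtain ⟨C, hC⟩ := Ray.endpoint_eq_iff.1 hce
  have hT' : (0 : ℝ) < T := hT
  have hL : 0 < dist o x := hT'.trans_le hTx
  have hcn : ∀ n : ℝ≥0, dist o (c.1 n) = n := fun n => by rw [← hc, c.dist_zero]
  have hen : ∀ n : ℝ≥0, dist x (e.1 n) = n := fun n => by rw [← he, e.dist_zero]
  have hD : Tendsto (fun n : ℕ => dist x (c.1 n)) atTop atTop := c.tendsto_dist x
  -- The ideal vertex is replaced by `c.1 n`. The hypothesis makes the comparison angle at `o`
  -- obtuse (`h2`), so the one at `x` is not (`h4`).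
  have hbig : ∀ᶠ n : ℕ in atTop,
      dist (hX.geod x (c.1 n) S) (σ' S) ^ 2 ≤ 2 * (S : ℝ) ^ 2 := by
    filter_upwards [eventually_ge_atTop ⌈(T : ℝ)⌉₊, hD.eventually_ge_atTop S,
      hD.eventually_gt_atTop 0] with n hn hSn hpos
    have hTn : (T : ℝ) ≤ n := Nat.ceil_le.1 hn
    have hn0 : (0 : ℝ) < n := hT'.trans_le hTn
    have hcs := c.isGeodesicSegment n
    rw [hc] at hcs
    have h1 := hX.dist_sq_le hcs hσ (by rw [hcn]; simpa using hn0) hL (s := T) (t := T)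
      ⟨T.2, by rw [hcn]; simpa using hTn⟩ ⟨T.2, hTx⟩
    rw [Real.toNNReal_coe, hcn, NNReal.coe_natCast] at h1
    have h2 : (n : ℝ) ^ 2 + dist o x ^ 2 - dist (c.1 n) x ^ 2 < 0 := by
      by_contra! hcon
      have : 0 ≤ (T : ℝ) * T * (((n : ℝ) ^ 2 + dist o x ^ 2 - dist (c.1 n) x ^ 2) /
        (n * dist o x)) := by positivity
      linarith
    have h3 := hX.dist_sq_le (hX.geod_spec x (c.1 n)) hσ' hpos (by rwa [dist_comm]) (s := S)
      (t := S) ⟨S.2, hSn⟩ ⟨S.2, by rwa [dist_comm]⟩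
    rw [dist_comm (c.1 n) o, hcn, NNReal.coe_natCast, dist_comm x o] at h3
    rw [dist_comm (c.1 n) x] at h2
    have h4 : 0 ≤ dist x (c.1 n) ^ 2 + dist o x ^ 2 - (n : ℝ) ^ 2 := by
      nlinarith [sq_nonneg (dist o x)]
    have : 0 ≤ (S : ℝ) * S * ((dist x (c.1 n) ^ 2 + dist o x ^ 2 - (n : ℝ) ^ 2) /
        (dist x (c.1 n) * dist o x)) := by positivity
    linarith
  -- The points `c.1 n` and `e.1 n` stay within `C` while receding from `x`, so the segments from
  -- `x` to `c.1 n` converge to `e`.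
  have hlim : Tendsto (fun n : ℕ => hX.geod x (c.1 n) S) atTop (𝓝 (e.1 S)) := by
    have hmin : Tendsto (fun n : ℕ => min (n : ℝ) (dist x (c.1 n))) atTop atTop :=
      tendsto_atTop.2 fun r => by
        filter_upwards [tendsto_natCast_atTop_atTop.eventually_ge_atTop r,
          hD.eventually_ge_atTop r] with n h1 h2 using le_min h1 h2
    have hz : Tendsto (fun n : ℕ => (S : ℝ) * (C / min (n : ℝ) (dist x (c.1 n)))) atTop (𝓝 0) := by
      simpa using (tendsto_const_nhds.div_atTop hmin).const_mul (S : ℝ)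
    refine tendsto_iff_dist_tendsto_zero.2 (squeeze_zero' (Eventually.of_forall fun _ =>
      dist_nonneg) ?_ hz)
    filter_upwards [hmin.eventually_gt_atTop 0, hmin.eventually_ge_atTop S] with n h0 hS
    have hes := e.isGeodesicSegment n
    rw [he] at hes
    have := hX.dist_le_mul_div (hX.geod_spec x (c.1 n)) hes h0 (min_le_right _ _)
      (by rw [hen]; simp) (s := S) S.2 (hS.trans (min_le_right _ _))
      (by rw [hen]; simpa using hS.trans (min_le_left _ _))
    rw [Real.toNNReal_coe] at this
    refine this.trans ?_
    gcongr
    exact hC n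
  exact le_of_tendsto ((hlim.dist tendsto_const_nhds).pow 2) hbig

/-! ### Orbits and limit points -/

/-- A sequence of points that leaves every ball has a subsequence converging to a boundary point. -/
theorem IsCAT0.exists_subseq_tendsto_boundary [ProperSpace X] (hX : IsCAT0 X) (o : X) {y : ℕ → X}
    (hy : Tendsto (fun i => dist o (y i)) atTop atTop) :
    ∃ φ : ℕ → ℕ, StrictMono φ ∧ ∃ n : Boundary X, ∀ k : ℕ,
      Tendsto (fun i => hX.geod o (y (φ i)) k) atTop (𝓝 ((hX.rayTo o n).1 k)) := by
  -- Natural times give a countable product of balls, which is sequentially compact; the minimum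
  -- keeps every parameter on its segment.
  obtain ⟨f, -, φ, hφ, hf⟩ := (isCompact_univ_pi (s := fun k : ℕ => Metric.closedBall o (k : ℝ))
    fun k => isCompact_closedBall o (k : ℝ)).tendsto_subseq
    (x := fun (i k : ℕ) => hX.geod o (y i) (min (k : ℝ) (dist o (y i)))) fun i k _ => by
      have hs := hX.geod_spec o (y i)
      have := hs.2.2 _ ⟨le_min k.cast_nonneg dist_nonneg, min_le_right (k : ℝ) _⟩ 0
        ⟨le_rfl, dist_nonneg⟩
      rw [hs.1, sub_zero, abs_of_nonneg (le_min k.cast_nonneg dist_nonneg)] at this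
      rw [Metric.mem_closedBall, this]
      exact min_le_left _ _
  have hyφ := hy.comp hφ.tendsto_atTop
  have hle : ((hyperfilter ℕ : Ultrafilter ℕ) : Filter ℕ) ≤ atTop := Nat.hyperfilter_le_atTop
  -- An ultrafilter supplies the limit ray at all real times; at natural times it agrees with the
  -- limit of the subsequence.
  obtain ⟨R, hR0, hR⟩ := exists_limit_ray (hyperfilter ℕ) o (fun i => hX.geod o (y (φ i)))
    (fun i => (hX.geod_spec _ _).1)
    (IsGeodesicSegment.eventually_isometry (fun i => hX.geod_spec _ _) (hyφ.mono_left hle))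
  refine ⟨φ, hφ, R.endpoint, fun k => ?_⟩
  have hk : Tendsto (fun i => hX.geod o (y (φ i)) k) atTop (𝓝 (f k)) := by
    refine (tendsto_pi_nhds.1 hf k).congr' ?_
    filter_upwards [hyφ.eventually_ge_atTop k] with i hi
    simp only [Function.comp_apply] at hi ⊢
    rw [min_eq_left hi]
  rw [← hX.eq_rayTo o hR0]
  convert hk
  have := hR k
  rw [NNReal.coe_natCast] at this
  exact tendsto_nhds_unique this (hk.mono_left hle)

theorem IsGeodesicSegment.smul {G : Type*} [Group G] [MulAction G X] [IsIsometricSMul G X]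
    {γ : ℝ → X} {x y : X} (h : IsGeodesicSegment γ x y) (g : G) :
    IsGeodesicSegment (fun t => g • γ t) (g • x) (g • y) := by
  simpa only [IsGeodesicSegment, dist_smul, smul_left_cancel_iff] using h

/-- Distinct elements of a properly acting group move a point out of every ball. -/
theorem tendsto_dist_smul {G : Type*} [Group G] [ProperSpace X] [MulAction G X]
    (hproper : ∀ K : Set X, IsCompact K →
      {g : G | (((fun x : X => g • x) '' K) ∩ K).Nonempty}.Finite)
    (o : X) {g : ℕ → G} (hg : Function.Injective g) :
    Tendsto (fun i => dist o (g i • o)) atTop atTop := by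
  refine tendsto_atTop.2 fun r => ?_
  have hfin := hproper _ (isCompact_closedBall o (max r 0))
  have := hg.tendsto_cofinite.eventually hfin.eventually_cofinite_notMem
  rw [Nat.cofinite_eq_atTop] at this
  filter_upwards [this] with i hi
  by_contra! hcon
  refine hi ⟨g i • o, ⟨o, Metric.mem_closedBall_self (le_max_right _ _), rfl⟩, ?_⟩
  rw [Metric.mem_closedBall, dist_comm]
  exact hcon.le.trans (le_max_left _ _)

/-- If `a` is not joined to `n` by a Lipschitz path, then the ray to `a` diverges fast from
segments whose endpoints tend to `n`. -/
theorem IsCAT0.exists_eventually_obtuse [ProperSpace X] (hX : IsCAT0 X) (o : X)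
    {Z : Type*} {τ : Boundary X → Z}
    (hτ : ∀ a b : Boundary X, titsDist a b ≤ ENNReal.ofReal (Real.pi / 2) → τ a = τ b)
    {ι : Type*} {l : Filter ι} {y : ι → X} {c : ι → Boundary X} {a n : Boundary X}
    (hy : ∀ k : ℕ, Tendsto (fun i => hX.geod o (y i) k) l (𝓝 ((hX.rayTo o n).1 k)))
    (hc : ∀ t, Tendsto (fun i => (hX.rayTo o (c i)).1 t) l (𝓝 ((hX.rayTo o a).1 t)))
    (hne : τ a ≠ τ n) :
    ∃ T : ℝ≥0, 0 < T ∧ ∀ᶠ i in l,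
      2 * (T : ℝ) ^ 2 < dist ((hX.rayTo o (c i)).1 T) (hX.geod o (y i) T) ^ 2 := by
  -- `√2 * k` is the base of a right isosceles triangle with legs `k`, and `√2 < 2` as the path
  -- construction requires.
  by_cases h : ∀ k : ℕ, dist ((hX.rayTo o a).1 k) ((hX.rayTo o n).1 k) ≤ √2 * k
  · obtain ⟨γ, rfl, rfl, M, hM, hγ⟩ := hX.exists_lipschitz_path o (Real.sqrt_nonneg 2)
      (by rw [Real.sqrt_lt' two_pos]; norm_num) h
    exact absurd (eq_of_lipschitz_path hτ hM hγ) hne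
  · push Not at h
    obtain ⟨k, hk⟩ := h
    have hlt : 2 * (k : ℝ) ^ 2 < dist ((hX.rayTo o a).1 k) ((hX.rayTo o n).1 k) ^ 2 := by
      have := pow_lt_pow_left₀ hk (by positivity) two_ne_zero
      rwa [mul_pow, Real.sq_sqrt zero_le_two] at this
    refine ⟨k, ?_, ?_⟩
    · rcases Nat.eq_zero_or_pos k with rfl | hpos
      · simp [hX.rayTo_zero] at hk
      · exact_mod_cast hpos
    · simp only [NNReal.coe_natCast]
      exact (((hc k).dist (hy k)).pow 2).eventually (lt_mem_nhds hlt)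

end CATZero

/-! ### The convergence property -/

open CATZero Filter Topology in
theorem mainTheorem7 {G X Z : Type*} [Group G]
    [MetricSpace X] [ProperSpace X] (hX : CATZero.IsCAT0 X)
    [MulAction G X] [IsIsometricSMul G X]
    (hproper : ∀ K : Set X, IsCompact K →
      {g : G | (((fun x : X => g • x) '' K) ∩ K).Nonempty}.Finite)
    (o : X)
    [TopologicalSpace Z] [MulAction G Z]
    (τ : CATZero.Boundary X → Z)
    (hquot : @Topology.IsQuotientMap _ _ (CATZero.visualTopology o) _ τ)
    (hequiv : ∀ (g : G) (a : CATZero.Boundary X), τ (g • a) = g • τ a)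
    (hτ : ∀ a b : CATZero.Boundary X,
      CATZero.titsDist a b ≤ ENNReal.ofReal (Real.pi / 2) → τ a = τ b) :
    CATZero.IsConvergenceAction G Z := by
  let _ := visualTopology o
  refine ⟨?_, fun g => ?_, fun g hg => ?_⟩
  · have := hX.compactSpace_boundary o
    exact hquot.surjective.compactSpace hquot.continuous
  · refine hquot.continuous_iff.2 ?_
    exact (hquot.continuous.comp (hX.continuous_smul_boundary o g)).congr fun a => hequiv g a
  -- The attracting point is a limit of `g i • o`, the repelling point a limit of `(g i)⁻¹ • o`.
  obtain ⟨φ, hφ, p, hp⟩ := hX.exists_subseq_tendsto_boundary o (tendsto_dist_smul hproper o hg)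
  have hinj : Function.Injective fun i => (g (φ i))⁻¹ :=
    inv_injective.comp (hg.comp hφ.injective)
  have hL := tendsto_dist_smul hproper o hinj
  obtain ⟨ψ, hψ, n, hn⟩ := hX.exists_subseq_tendsto_boundary o hL
  replace hp := fun k => (hp k).comp hψ.tendsto_atTop
  replace hL := hL.comp hψ.tendsto_atTop
  refine ⟨φ ∘ ψ, hφ.comp hψ, τ n, τ p, fun K hK hnK U hU hpU => ?_⟩
  simp only [Function.comp_def] at hp hL ⊢
  generalize hh : (fun i => g (φ (ψ i))) = h at *
  have hh' : ∀ i, g (φ (ψ i)) = h i := fun i => congrFun hh i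
  simp only [hh'] at hp hn hL ⊢
  by_contra hcon
  rw [not_eventually] at hcon
  push Not at hcon
  have : NeBot (atTop ⊓ 𝓟 {i | ∃ z ∈ K, h i • z ∉ U}) := frequently_mem_iff_neBot.1 hcon
  -- An ultrafilter on the bad indices makes all the boundary points below converge without further
  -- subsequences.
  let l := Ultrafilter.of (atTop ⊓ 𝓟 {i | ∃ z ∈ K, h i • z ∉ U})
  have hl : (l : Filter ℕ) ≤ atTop ⊓ 𝓟 {i | ∃ z ∈ K, h i • z ∉ U} := Ultrafilter.of_le _
  have hl1 : (l : Filter ℕ) ≤ atTop := hl.trans inf_le_left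
  have hbad : ∀ᶠ i in l, ∃ a : Boundary X, τ a ∈ K ∧ τ (h i • a) ∉ U := by
    filter_upwards [le_principal_iff.1 (hl.trans inf_le_right)] with i hi
    obtain ⟨z, hz, hzU⟩ := hi
    obtain ⟨a, rfl⟩ := hquot.surjective z
    exact ⟨a, hz, by rwa [hequiv]⟩
  obtain ⟨c, hc⟩ := hbad.choice
  obtain ⟨a, ha⟩ := hX.exists_tendsto_rayTo o l c
  obtain ⟨b, hb⟩ := hX.exists_tendsto_rayTo o l fun i => h i • c i
  have haK : τ a ∈ K := (hK.preimage hquot.continuous).mem_of_tendsto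
    ((hX.tendsto_nhds_iff o).2 ha) (hc.mono fun i hi => hi.1)
  have hbU : τ b ∈ Uᶜ := (hU.isClosed_compl.preimage hquot.continuous).mem_of_tendsto
    ((hX.tendsto_nhds_iff o).2 hb) (hc.mono fun i hi => hi.2)
  obtain ⟨T, hT, hTl⟩ := hX.exists_eventually_obtuse o hτ (fun k => (hn k).mono_left hl1) ha
    (fun he => hnK (he ▸ haK))
  obtain ⟨S, -, hSl⟩ := hX.exists_eventually_obtuse o hτ (fun k => (hp k).mono_left hl1) hb
    (fun he => hbU (he ▸ hpU))
  replace hL := hL.mono_left hl1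
  obtain ⟨i, hi1, hi2, hi3, hi4⟩ := (hTl.and (hSl.and ((hL.eventually_ge_atTop T).and
    (hL.eventually_ge_atTop S)))).exists
  -- The obtuse angle at `o` between `h i • o` and `h i • c i` is carried by `(h i)⁻¹` to the vertex
  -- `(h i)⁻¹ • o` of the triangle with `o` and `c i`.
  have hseg := (hX.geod_spec o (h i • o)).smul (h i)⁻¹
  rw [inv_smul_smul] at hseg
  have := hX.not_both_obtuse (hX.geod_spec o ((h i)⁻¹ • o)) hseg (c := hX.rayTo o (c i))
    (e := (h i)⁻¹ • hX.rayTo o (h i • c i)) (hX.rayTo_zero o _)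
    (by rw [Ray.smul_apply, hX.rayTo_zero])
    (by rw [Ray.smul_endpoint, hX.rayTo_endpoint, hX.rayTo_endpoint, inv_smul_smul])
    hT hi3 hi4 hi1
  rw [Ray.smul_apply, dist_smul] at this
  exact absurd hi2 this.not_gt
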